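/- For a complex $n\times n$ matrix $A$ let $\|A\|_{tr}=\sqrt{\frac1n\sum_{i,j}|A_{ij}|^2}$ be the normalized Hilbert--Schmidt norm, let $\|A\|_{op}$ be the operator norm of $A$ acting on the Hilbert space $\mathbb C^n$, and let $[A,B]=AB-BA$. (1) There is a function $\delta(\epsilon,k)$, independent of the dimension $n$, with $\delta(\epsilon,k)\to 0$ as $\epsilon\to 0^+$ for every $k\in\mathbb N$, such that for all $k,n\in\mathbb N$ and all $\epsilon\ge 0$: if $H_1,\dots,H_k$ are self-adjoint $n\times n$ matrices with $\|H_i\|_{op}\le 1$ and $\|[H_i,H_j]\|_{tr}\le\epsilon$ for all $i,j$, then there exist pairwise commuting self-adjoint $n\times n$ matrices $A_1,\dots,A_k$ with $\|A_j\|_{op}\le 1$ and $\|H_j-A_j\|_{tr}\le\delta(\epsilon,k)$ for all $j$. (2) Likewise, there is a function $\delta'(\epsilon,k)$, independent of $n$, with $\delta'(\epsilon,k)\to 0$ as $\epsilon\to 0^+$ for every $k\in\mathbb N$, such that for all $k,n\in\mathbb N$ and all $\epsilon\ge 0$: if $N_1,\dots,N_k$ are normal $n\times n$ matrices with $\|N_i\|_{op}\le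 1$ and $\|[N_i,N_j]\|_{tr}\le\epsilon$ for all $i,j$, then there exist pairwise commuting normal $n\times n$ matrices $M_1,\dots,M_k$ with $\|N_j-M_j\|_{tr}\le\delta'(\epsilon,k)$ for all $j$. -/

import Mathlib

open Filter Topology

noncomputable section

/-- The normalized Hilbert-Schmidt norm
`‖A‖_tr = √((1/n) ∑_{j,k} |A_{jk}|²)` of a complex `n × n` matrix. -/
def trNorm {n : ℕ} (A : Matrix (Fin n) (Fin n) ℂ) : ℝ :=
  Real.sqrt ((1 / (n : ℝ)) * ∑ j, ∑ k, ‖A j k‖ ^ 2)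

/-- The operator norm `‖A‖_op` of a complex `n × n` matrix acting on the Hilbert space `ℂⁿ`. -/
def opNorm {n : ℕ} (A : Matrix (Fin n) (Fin n) ℂ) : ℝ :=
  ‖Matrix.toEuclideanCLM (n := Fin n) (𝕜 := ℂ) A‖

end

/-!
Almost commuting contractions are near commuting ones in the normalized Hilbert–Schmidt norm,
uniformly in the dimension, because this norm tolerates sharp spectral cut-offs at random places.

Let `H` be a Hermitian contraction with eigenvalues `d a`, and let `X` be a contraction with
`‖[H, X]‖_tr ≤ ε`. In an eigenbasis of `H` one has `|[H, X] a b| = |d a - d b| |X a b|`. Cut the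
real line into bins of width `h` with a uniformly random shift: `d a` and `d b` fall into different
bins with probability at most `|d a - d b| / h`. Hence deleting the entries of `X` that join
different bins (`pinch`) costs, in expected squared norm, at most
`(1 / n) ∑ |X a b|² |d a - d b| / h ≤ ‖X‖_tr ‖[H, X]‖_tr / h ≤ ε / h` by the Cauchy–Schwarz
inequality, and, with an extra factor `k`, one shift serves `k` matrices `X` at once
(`exists_trNorm_sub_pinch_sq_le`). Replacing each `d a` by the end point of its bin moves `H` by at
most `h` and gives a matrix which commutes with all pinched matrices. With `h = √ε` both errors tend
to zero with `ε`, independently of the dimension. Pinching keeps matrices Hermitian and contractive,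
and it does not destroy exact commutation relations with matrices that commute with `H`
(`exists_commute_of_trNorm_commutator_le`). The members of a family can therefore be treated one
after the other (`exists_commute_finset`), and the accumulated error is `discretizationError`.

For normal matrices the Hilbert–Schmidt norm of `[N, X]` equals that of `[N*, X]`
(`trNorm_commutator_conjTranspose_left`), so the real and imaginary parts of an almost commuting
family are again almost commuting, and the Hermitian case applies to them.
-/

/-! ### The normalized Hilbert–Schmidt norm and the operator norm -/

section Norms

variable {n : ℕ} (A B : Matrix (Fin n) (Fin n) ℂ)

theorem trNorm_nonneg : 0 ≤ trNorm A := Real.sqrt_nonneg _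

theorem trNorm_sq : trNorm A ^ 2 = (1 / (n : ℝ)) * ∑ j, ∑ k, ‖A j k‖ ^ 2 :=
  Real.sq_sqrt (by positivity)

section

open scoped Matrix.Norms.Frobenius

theorem trNorm_eq_frobenius : trNorm A = √(1 / (n : ℝ)) * ‖A‖ := by
  rw [trNorm, Real.sqrt_mul (by positivity), Matrix.frobenius_norm_def, Real.sqrt_eq_rpow (∑ j, _)]
  simp

theorem trNorm_add_le : trNorm (A + B) ≤ trNorm A + trNorm B := by
  simp only [trNorm_eq_frobenius, ← mul_add]
  gcongr
  exact norm_add_le A B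

theorem trNorm_neg : trNorm (-A) = trNorm A := by
  simp [trNorm]

theorem trNorm_smul (c : ℂ) : trNorm (c • A) = ‖c‖ * trNorm A := by
  rw [trNorm_eq_frobenius, trNorm_eq_frobenius, norm_smul]
  ring

theorem trNorm_conjTranspose : trNorm A.conjTranspose = trNorm A := by
  simp only [trNorm_eq_frobenius, Matrix.frobenius_norm_conjTranspose]

end

theorem trNorm_sub_rev : trNorm (A - B) = trNorm (B - A) := by
  rw [← trNorm_neg, neg_sub]

theorem trNorm_sub_le : trNorm (A - B) ≤ trNorm A + trNorm B := by
  simpa only [sub_eq_add_neg, trNorm_neg] using trNorm_add_le A (-B)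

theorem trNorm_zero : trNorm (0 : Matrix (Fin n) (Fin n) ℂ) = 0 := by
  simp [trNorm]

theorem eq_zero_of_trNorm_le_zero {A : Matrix (Fin n) (Fin n) ℂ} (h : trNorm A ≤ 0) : A = 0 := by
  ext a b
  have hn : (0 : ℝ) < n := by exact_mod_cast a.pos
  have h0 : trNorm A ^ 2 = 0 := by rw [le_antisymm h (trNorm_nonneg A)]; simp
  rw [trNorm_sq, mul_eq_zero, or_iff_right (by positivity),
    Finset.sum_eq_zero_iff_of_nonneg (fun _ _ => by positivity)] at h0
  have h1 := (Finset.sum_eq_zero_iff_of_nonneg (fun _ _ => by positivity)).1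
    (h0 a (Finset.mem_univ a)) b (Finset.mem_univ b)
  simpa using h1

theorem ofReal_sum_norm_sq_eq_trace :
    ((∑ j, ∑ k, ‖A j k‖ ^ 2 : ℝ) : ℂ) = (A.conjTranspose * A).trace := by
  rw [Finset.sum_comm]
  simp only [Matrix.trace, Matrix.diag_apply, Matrix.mul_apply, Matrix.conjTranspose_apply,
    Complex.ofReal_sum, Complex.star_def, Complex.conj_mul', Complex.ofReal_pow]

theorem trNorm_eq_of_trace_eq {A B : Matrix (Fin n) (Fin n) ℂ}
    (h : (A.conjTranspose * A).trace = (B.conjTranspose * B).trace) : trNorm A = trNorm B := by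
  rw [← ofReal_sum_norm_sq_eq_trace, ← ofReal_sum_norm_sq_eq_trace] at h
  rw [trNorm, trNorm, Complex.ofReal_injective h]

/-- A quantitative Fuglede theorem in the Hilbert–Schmidt norm, obtained by expanding both squared
norms as traces and permuting factors cyclically. -/
theorem trNorm_commutator_conjTranspose_left {N : Matrix (Fin n) (Fin n) ℂ} (hN : IsStarNormal N)
    (X : Matrix (Fin n) (Fin n) ℂ) :
    trNorm (N.conjTranspose * X - X * N.conjTranspose) = trNorm (N * X - X * N) := by
  apply trNorm_eq_of_trace_eq
  have hc : N.conjTranspose * N = N * N.conjTranspose := hN.star_comm_self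
  simp only [Matrix.conjTranspose_sub, Matrix.conjTranspose_mul, Matrix.conjTranspose_conjTranspose,
    sub_mul, mul_sub, Matrix.trace_sub]
  have h1 : (X.conjTranspose * N * (N.conjTranspose * X)).trace =
      (X.conjTranspose * N.conjTranspose * (N * X)).trace := by
    simp only [Matrix.mul_assoc]
    rw [← Matrix.mul_assoc N, ← hc, Matrix.mul_assoc]
  have h2 : (X.conjTranspose * N * (X * N.conjTranspose)).trace =
      (N.conjTranspose * X.conjTranspose * (N * X)).trace := by
    rw [← Matrix.mul_assoc, Matrix.trace_mul_comm]
    simp only [Matrix.mul_assoc]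
  have h3 : (N * X.conjTranspose * (N.conjTranspose * X)).trace =
      (X.conjTranspose * N.conjTranspose * (X * N)).trace := by
    rw [Matrix.mul_assoc, Matrix.trace_mul_comm]
    simp only [Matrix.mul_assoc]
  have h4 : (N * X.conjTranspose * (X * N.conjTranspose)).trace =
      (N.conjTranspose * X.conjTranspose * (X * N)).trace := by
    rw [Matrix.mul_assoc, Matrix.trace_mul_comm, ← Matrix.mul_assoc, Matrix.mul_assoc _ _ N, hc,
      Matrix.mul_assoc N.conjTranspose, Matrix.trace_mul_comm N.conjTranspose]
    simp only [Matrix.mul_assoc]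
  rw [h1, h2, h3, h4]
  ring

theorem sum_norm_mul_norm_le :
    (1 / (n : ℝ)) * ∑ j, ∑ k, ‖A j k‖ * ‖B j k‖ ≤ trNorm A * trNorm B := by
  rw [trNorm, trNorm, Real.sqrt_mul (by positivity), Real.sqrt_mul (by positivity),
    mul_mul_mul_comm, Real.mul_self_sqrt (by positivity)]
  gcongr
  simp only [← Finset.sum_product']
  exact Real.sum_mul_le_sqrt_mul_sqrt _ _ _

section

open scoped Matrix.Norms.L2Operator

theorem opNorm_eq_norm : opNorm A = ‖A‖ := Matrix.l2_opNorm_toEuclideanCLM A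

theorem opNorm_nonneg : 0 ≤ opNorm A := norm_nonneg _

theorem opNorm_conjTranspose : opNorm A.conjTranspose = opNorm A := by
  rw [opNorm_eq_norm, opNorm_eq_norm, Matrix.l2_opNorm_conjTranspose]

theorem opNorm_diagonal (v : Fin n → ℂ) : opNorm (Matrix.diagonal v) = ‖v‖ := by
  rw [opNorm_eq_norm, Matrix.l2_opNorm_diagonal]

theorem opNorm_conjStarAlgAut (u : unitary (Matrix (Fin n) (Fin n) ℂ)) :
    opNorm (Unitary.conjStarAlgAut ℂ _ u A) = opNorm A := by
  rw [opNorm_eq_norm, opNorm_eq_norm, Unitary.conjStarAlgAut_apply]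
  rw [← Unitary.coe_star, CStarRing.norm_mul_coe_unitary, CStarRing.norm_coe_unitary_mul]

theorem opNorm_realPart_le : opNorm (realPart A : Matrix (Fin n) (Fin n) ℂ) ≤ opNorm A := by
  rw [opNorm_eq_norm, opNorm_eq_norm]
  exact realPart.norm_le A

theorem opNorm_imaginaryPart_le :
    opNorm (imaginaryPart A : Matrix (Fin n) (Fin n) ℂ) ≤ opNorm A := by
  rw [opNorm_eq_norm, opNorm_eq_norm]
  exact imaginaryPart.norm_le A

end

theorem sum_norm_sq_mulVec_le (v : Fin n → ℂ) :
    ∑ j, ‖A.mulVec v j‖ ^ 2 ≤ opNorm A ^ 2 * ∑ j, ‖v j‖ ^ 2 := by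
  have h := (Matrix.toEuclideanCLM (n := Fin n) (𝕜 := ℂ) A).le_opNorm (WithLp.toLp 2 v)
  have h' := pow_le_pow_left₀ (norm_nonneg _) h 2
  rw [mul_pow, EuclideanSpace.norm_sq_eq, EuclideanSpace.norm_sq_eq] at h'
  simpa [opNorm] using h'

theorem opNorm_le_one_of_sum_le
    (h : ∀ v : Fin n → ℂ, ∑ j, ‖A.mulVec v j‖ ^ 2 ≤ ∑ j, ‖v j‖ ^ 2) : opNorm A ≤ 1 := by
  refine ContinuousLinearMap.opNorm_le_bound _ zero_le_one fun x => ?_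
  rw [one_mul, ← sq_le_sq₀ (norm_nonneg _) (norm_nonneg _), EuclideanSpace.norm_sq_eq,
    EuclideanSpace.norm_sq_eq]
  simpa using h x.ofLp

theorem trNorm_conjStarAlgAut (u : unitary (Matrix (Fin n) (Fin n) ℂ)) :
    trNorm (Unitary.conjStarAlgAut ℂ _ u A) = trNorm A := by
  apply trNorm_eq_of_trace_eq
  rw [← Matrix.star_eq_conjTranspose, ← Matrix.star_eq_conjTranspose, ← map_star, ← map_mul,
    Unitary.conjStarAlgAut_apply, Matrix.trace_mul_comm, ← mul_assoc, Unitary.coe_star_mul_self,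
    one_mul]

theorem trNorm_mul_le_opNorm_mul : trNorm (A * B) ≤ opNorm A * trNorm B := by
  have h : ∑ j, ∑ k, ‖(A * B) j k‖ ^ 2 ≤ opNorm A ^ 2 * ∑ j, ∑ k, ‖B j k‖ ^ 2 := by
    rw [Finset.sum_comm, Finset.sum_comm (f := fun j k => ‖B j k‖ ^ 2), Finset.mul_sum]
    exact Finset.sum_le_sum fun k _ => sum_norm_sq_mulVec_le A (fun j => B j k)
  rw [← sq_le_sq₀ (trNorm_nonneg _) (mul_nonneg (opNorm_nonneg _) (trNorm_nonneg _)), mul_pow,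
    trNorm_sq, trNorm_sq, mul_left_comm]
  gcongr

theorem trNorm_mul_le_mul_opNorm : trNorm (A * B) ≤ trNorm A * opNorm B := by
  rw [← trNorm_conjTranspose, Matrix.conjTranspose_mul, mul_comm, ← trNorm_conjTranspose A,
    ← opNorm_conjTranspose B]
  exact trNorm_mul_le_opNorm_mul _ _

theorem trNorm_diagonal_le {v : Fin n → ℂ} {c : ℝ} (hc : 0 ≤ c) (h : ∀ a, ‖v a‖ ≤ c) :
    trNorm (Matrix.diagonal v) ≤ c := by
  have h1 : trNorm (1 : Matrix (Fin n) (Fin n) ℂ) ≤ 1 := by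
    rw [trNorm, Real.sqrt_le_one]
    have : ∀ j : Fin n, ∑ k, ‖(1 : Matrix (Fin n) (Fin n) ℂ) j k‖ ^ 2 = 1 := fun j => by
      rw [Finset.sum_eq_single j] <;> simp +contextual [eq_comm]
    simp only [this]
    simpa using inv_mul_le_one (G₀ := ℝ) (a := n)
  calc trNorm (Matrix.diagonal v) = trNorm (Matrix.diagonal v * 1) := by rw [mul_one]
    _ ≤ opNorm (Matrix.diagonal v) * trNorm (1 : Matrix (Fin n) (Fin n) ℂ) :=
      trNorm_mul_le_opNorm_mul _ _
    _ ≤ c * 1 := by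
      refine mul_le_mul ?_ h1 (trNorm_nonneg _) hc
      rw [opNorm_diagonal]
      exact (pi_norm_le_iff_of_nonneg hc).2 h
    _ = c := mul_one c

theorem trNorm_le_opNorm : trNorm A ≤ opNorm A := by
  have h1 : trNorm (1 : Matrix (Fin n) (Fin n) ℂ) ≤ 1 := by
    rw [← Matrix.diagonal_one]
    exact trNorm_diagonal_le zero_le_one (by simp)
  calc trNorm A = trNorm (A * 1) := by rw [mul_one]
    _ ≤ opNorm A * trNorm (1 : Matrix (Fin n) (Fin n) ℂ) := trNorm_mul_le_opNorm_mul _ _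
    _ ≤ opNorm A := mul_le_of_le_one_right (opNorm_nonneg A) h1

end Norms

/-- Commutators of contractions depend Lipschitz-continuously on their entries. -/
theorem trNorm_commutator_le {n : ℕ} {A B A' B' : Matrix (Fin n) (Fin n) ℂ} {ε δ : ℝ}
    (hA : opNorm A ≤ 1) (hB : opNorm B ≤ 1) (hA' : opNorm A' ≤ 1) (hB' : opNorm B' ≤ 1)
    (hAB : trNorm (A * B - B * A) ≤ ε) (hAA' : trNorm (A - A') ≤ δ) (hBB' : trNorm (B - B') ≤ δ) :
    trNorm (A' * B' - B' * A') ≤ ε + 4 * δ := by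
  have e : A' * B' - B' * A' = A * B - B * A - (A - A') * B - A' * (B - B')
      + (B - B') * A + B' * (A - A') := by noncomm_ring
  have l : ∀ X C : Matrix (Fin n) (Fin n) ℂ, opNorm C ≤ 1 → trNorm (C * X) ≤ trNorm X :=
    fun X C h => (trNorm_mul_le_opNorm_mul C X).trans (mul_le_of_le_one_left (trNorm_nonneg X) h)
  have r : ∀ X C : Matrix (Fin n) (Fin n) ℂ, opNorm C ≤ 1 → trNorm (X * C) ≤ trNorm X :=
    fun X C h => (trNorm_mul_le_mul_opNorm X C).trans (mul_le_of_le_one_right (trNorm_nonneg X) h)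
  rw [e]
  linarith [trNorm_add_le (A * B - B * A - (A - A') * B - A' * (B - B') + (B - B') * A)
      (B' * (A - A')), trNorm_add_le (A * B - B * A - (A - A') * B - A' * (B - B')) ((B - B') * A),
    trNorm_sub_le (A * B - B * A - (A - A') * B) (A' * (B - B')),
    trNorm_sub_le (A * B - B * A) ((A - A') * B), r (A - A') B hB, l (B - B') A' hA',
    r (B - B') A hA, l (A - A') B' hB']

/-! ### Random rounding -/

theorem integral_floor_add (x : ℝ) : ∫ θ in (0 : ℝ)..1, (⌊x + θ⌋ : ℝ) = x := by
  have hi : ∀ a b : ℝ, IntervalIntegrable (fun t : ℝ => (⌊t⌋ : ℝ)) MeasureTheory.volume a b :=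
    fun a b => (Int.cast_mono.comp Int.floor_mono).intervalIntegrable
  have hper : Function.Periodic (Int.fract : ℝ → ℝ) 1 := fun t => Int.fract_add_one t
  have hf : ∫ t in x..x + 1, Int.fract t = 1 / 2 := by
    rw [hper.intervalIntegral_add_eq x 0, zero_add]
    rw [intervalIntegral.integral_congr_Ioo_of_le (g := fun t : ℝ => t) zero_le_one]
    · norm_num [integral_id]
    · intro t ht
      exact Int.fract_eq_self.2 ⟨ht.1.le, ht.2⟩
  rw [intervalIntegral.integral_comp_add_left (fun t : ℝ => (⌊t⌋ : ℝ)) x, add_zero]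
  have h : ∫ t in x..x + 1, Int.fract t = ∫ t in x..x + 1, (t - (⌊t⌋ : ℝ)) := rfl
  rw [hf, intervalIntegral.integral_sub (by simp) (hi _ _), integral_id] at h
  linarith

theorem intervalIntegrable_floor_add (x : ℝ) :
    IntervalIntegrable (fun θ : ℝ => (⌊x + θ⌋ : ℝ)) MeasureTheory.volume 0 1 :=
  Monotone.intervalIntegrable fun a b h => by gcongr

theorem integral_abs_floor_sub_floor (x y : ℝ) :
    ∫ θ in (0 : ℝ)..1, |(⌊x + θ⌋ : ℝ) - ⌊y + θ⌋| = |x - y| := by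
  wlog hxy : y ≤ x generalizing x y
  · simpa only [abs_sub_comm] using this y x (le_of_not_ge hxy)
  have h : ∀ θ : ℝ, |(⌊x + θ⌋ : ℝ) - ⌊y + θ⌋| = ⌊x + θ⌋ - ⌊y + θ⌋ := fun θ =>
    abs_of_nonneg (sub_nonneg.2 (by gcongr))
  simp only [h]
  rw [intervalIntegral.integral_sub (intervalIntegrable_floor_add x)
    (intervalIntegrable_floor_add y), integral_floor_add, integral_floor_add,
    abs_of_nonneg (sub_nonneg.2 hxy)]

/-- First-moment method: some shift `θ` does at least as well as a uniformly random one, for which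
the expected distance between the roundings of two points is the distance of the points. -/
theorem exists_sum_mul_abs_floor_sub_floor_le {I : Type*} [Fintype I] (w x y : I → ℝ) :
    ∃ θ : ℝ, ∑ i, w i * |(⌊x i + θ⌋ : ℝ) - ⌊y i + θ⌋| ≤ ∑ i, w i * |x i - y i| := by
  have hint : ∀ i, IntervalIntegrable (fun θ : ℝ => w i * |(⌊x i + θ⌋ : ℝ) - ⌊y i + θ⌋|)
      MeasureTheory.volume 0 1 := fun i =>
    (((intervalIntegrable_floor_add (x i)).sub (intervalIntegrable_floor_add (y i))).abs).const_mul _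
  have : MeasureTheory.IsProbabilityMeasure
      (MeasureTheory.volume.restrict (Set.Ioc (0 : ℝ) 1)) := ⟨by simp⟩
  obtain ⟨θ, hθ⟩ := MeasureTheory.exists_le_integral
    (μ := MeasureTheory.volume.restrict (Set.Ioc (0 : ℝ) 1))
    (f := fun θ : ℝ => ∑ i, w i * |(⌊x i + θ⌋ : ℝ) - ⌊y i + θ⌋|)
    (MeasureTheory.integrable_finsetSum _ fun i _ => (hint i).1)
  refine ⟨θ, hθ.trans (le_of_eq ?_)⟩
  rw [← intervalIntegral.integral_of_le zero_le_one,
    intervalIntegral.integral_finsetSum fun i _ => hint i]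
  simp only [intervalIntegral.integral_const_mul, integral_abs_floor_sub_floor]

/-! ### Pinching -/

/-- The pinching of `X` along the partition of the basis into the fibres of `z`: the blocks of `X`
joining different fibres are replaced by zero. -/
def pinch {n : ℕ} {β : Type*} [DecidableEq β] (z : Fin n → β) (X : Matrix (Fin n) (Fin n) ℂ) :
    Matrix (Fin n) (Fin n) ℂ :=
  Matrix.of fun a b => if z a = z b then X a b else 0

section Pinch

variable {n : ℕ} {β : Type*} [DecidableEq β] (z : Fin n → β) {X : Matrix (Fin n) (Fin n) ℂ}

theorem pinch_apply (a b : Fin n) : pinch z X a b = if z a = z b then X a b else 0 := rfl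

theorem isHermitian_pinch (hX : X.IsHermitian) : (pinch z X).IsHermitian := by
  ext a b
  rw [Matrix.conjTranspose_apply, pinch_apply, pinch_apply, apply_ite star, hX.apply, star_zero]
  simp only [eq_comm]

/-- On each fibre, `pinch z X` acts as the compression of `X` to that fibre; summing the norms over
the fibres gives the bound. -/
theorem opNorm_pinch_le_one (hX : opNorm X ≤ 1) : opNorm (pinch z X) ≤ 1 := by
  refine opNorm_le_one_of_sum_le _ fun v => ?_
  let r : β → Fin n → ℂ := fun s b => if z b = s then v b else 0
  have hfib : ∀ f : Fin n → ℝ, ∑ a, f a =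
      ∑ s ∈ Finset.univ.image z, ∑ a with z a = s, f a := fun f =>
    (Finset.sum_fiberwise_of_maps_to
      (fun a _ => Finset.mem_image_of_mem z (Finset.mem_univ a)) f).symm
  rw [hfib, hfib]
  refine Finset.sum_le_sum fun s _ => ?_
  have h1 : ∑ a with z a = s, ‖(pinch z X).mulVec v a‖ ^ 2
      = ∑ a with z a = s, ‖X.mulVec (r s) a‖ ^ 2 := by
    refine Finset.sum_congr rfl fun a ha => ?_
    obtain rfl : z a = s := by simpa using ha
    congr 2
    simp only [Matrix.mulVec, dotProduct, pinch_apply, r]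
    refine Finset.sum_congr rfl fun b _ => ?_
    by_cases h : z a = z b
    · simp [h]
    · simp [h, Ne.symm h]
  have h2 : ∑ b, ‖r s b‖ ^ 2 = ∑ a with z a = s, ‖v a‖ ^ 2 := by
    rw [Finset.sum_filter]
    refine Finset.sum_congr rfl fun b _ => ?_
    by_cases h : z b = s <;> simp [r, h]
  rw [h1, ← h2]
  calc ∑ a with z a = s, ‖X.mulVec (r s) a‖ ^ 2 ≤ ∑ a, ‖X.mulVec (r s) a‖ ^ 2 :=
        Finset.sum_le_sum_of_subset_of_nonneg (Finset.filter_subset _ _) fun _ _ _ => by positivity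
    _ ≤ opNorm X ^ 2 * ∑ b, ‖r s b‖ ^ 2 := sum_norm_sq_mulVec_le X (r s)
    _ ≤ ∑ b, ‖r s b‖ ^ 2 :=
      mul_le_of_le_one_left (by positivity) (pow_le_one₀ (opNorm_nonneg X) hX)

theorem commute_diagonal_pinch (φ : β → ℂ) :
    Commute (Matrix.diagonal fun a => φ (z a)) (pinch z X) := by
  ext a b
  rw [Matrix.diagonal_mul, Matrix.mul_diagonal, pinch_apply]
  split_ifs with h
  · rw [h, mul_comm]
  · simp

theorem pinch_eq_self (h : ∀ a b, X a b ≠ 0 → z a = z b) : pinch z X = X := by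
  ext a b
  rw [pinch_apply]
  split_ifs with hz
  · rfl
  · exact (not_imp_comm.1 (h a b) hz).symm

theorem commute_pinch {B : Matrix (Fin n) (Fin n) ℂ} (hB : ∀ a b, B a b ≠ 0 → z a = z b)
    (hBX : Commute B X) : Commute B (pinch z X) := by
  have hl : B * pinch z X = pinch z (B * X) := by
    ext a b
    rw [pinch_apply, Matrix.mul_apply, Matrix.mul_apply]
    by_cases hz : z a = z b
    · rw [if_pos hz]
      refine Finset.sum_congr rfl fun c _ => ?_
      by_cases hc : B a c = 0
      · simp [hc]
      · rw [pinch_apply, if_pos ((hB a c hc).symm.trans hz)]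
    · rw [if_neg hz]
      refine Finset.sum_eq_zero fun c _ => ?_
      by_cases hc : B a c = 0
      · simp [hc]
      · rw [pinch_apply, if_neg (hB a c hc ▸ hz), mul_zero]
  have hr : pinch z X * B = pinch z (X * B) := by
    ext a b
    rw [pinch_apply, Matrix.mul_apply, Matrix.mul_apply]
    by_cases hz : z a = z b
    · rw [if_pos hz]
      refine Finset.sum_congr rfl fun c _ => ?_
      by_cases hc : B c b = 0
      · simp [hc]
      · rw [pinch_apply, if_pos (hz.trans (hB c b hc).symm)]
    · rw [if_neg hz]
      refine Finset.sum_eq_zero fun c _ => ?_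
      by_cases hc : B c b = 0
      · simp [hc]
      · rw [pinch_apply, if_neg (fun h => hz (h.trans (hB c b hc))), zero_mul]
  rw [Commute, SemiconjBy, hl, hr, hBX.eq]

end Pinch

theorem apply_eq_of_commute_diagonal {n : ℕ} {d : Fin n → ℝ} {X : Matrix (Fin n) (Fin n) ℂ}
    (h : Commute X (Matrix.diagonal fun a => (d a : ℂ))) {a b : Fin n} (hX : X a b ≠ 0) :
    d a = d b := by
  have h1 := congrFun (congrFun h.eq a) b
  rw [Matrix.diagonal_mul, Matrix.mul_diagonal, mul_comm] at h1
  exact_mod_cast (mul_right_cancel₀ hX h1).symm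

/-- For a random shift of the bins, the entry `X a b` is deleted by the pinching with probability at
most `|d a - d b| / h`, and the resulting mean squared error is controlled by the commutator of
`X` with the diagonal matrix via the Cauchy–Schwarz inequality. -/
theorem exists_trNorm_sub_pinch_sq_le {n : ℕ} {ι : Type*} [Fintype ι] (d : Fin n → ℝ)
    (X : ι → Matrix (Fin n) (Fin n) ℂ) (hX : ∀ j, opNorm (X j) ≤ 1) {ε h : ℝ} (hh : 0 < h)
    (hc : ∀ j, trNorm (Matrix.diagonal (fun a => (d a : ℂ)) * X j
      - X j * Matrix.diagonal (fun a => (d a : ℂ))) ≤ ε) :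
    ∃ θ : ℝ, ∀ j, trNorm (X j - pinch (fun a => ⌊d a / h + θ⌋) (X j)) ^ 2
      ≤ Fintype.card ι * ε / h := by
  obtain ⟨θ, hθ⟩ := exists_sum_mul_abs_floor_sub_floor_le (I := ι × Fin n × Fin n)
    (fun i => 1 / (n : ℝ) * ‖X i.1 i.2.1 i.2.2‖ ^ 2) (fun i => d i.2.1 / h) (fun i => d i.2.2 / h)
  simp only [Fintype.sum_prod_type] at hθ
  refine ⟨θ, fun j => ?_⟩
  have hl : ∀ j, trNorm (X j - pinch (fun a => ⌊d a / h + θ⌋) (X j)) ^ 2 ≤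
      ∑ a, ∑ b, 1 / (n : ℝ) * ‖X j a b‖ ^ 2 * |(⌊d a / h + θ⌋ : ℝ) - ⌊d b / h + θ⌋| := fun j => by
    rw [trNorm_sq, Finset.mul_sum]
    refine Finset.sum_le_sum fun a _ => ?_
    rw [Finset.mul_sum]
    refine Finset.sum_le_sum fun b _ => ?_
    rw [Matrix.sub_apply, pinch_apply]
    split_ifs with hz
    · rw [sub_self, norm_zero, zero_pow two_ne_zero, mul_zero]
      positivity
    · rw [sub_zero]
      refine le_mul_of_one_le_right (by positivity) ?_
      exact_mod_cast Int.one_le_abs (sub_ne_zero.2 hz)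
  have hr : ∀ j, ∑ a, ∑ b, 1 / (n : ℝ) * ‖X j a b‖ ^ 2 * |d a / h - d b / h| ≤ ε / h := fun j => by
    have hcs := sum_norm_mul_norm_le (X j) (Matrix.diagonal (fun a => (d a : ℂ)) * X j
      - X j * Matrix.diagonal (fun a => (d a : ℂ)))
    have hb : trNorm (X j) * trNorm (Matrix.diagonal (fun a => (d a : ℂ)) * X j
        - X j * Matrix.diagonal (fun a => (d a : ℂ))) ≤ ε :=
      (mul_le_of_le_one_left (trNorm_nonneg _) ((trNorm_le_opNorm _).trans (hX j))).trans (hc j)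
    refine le_trans (le_of_eq ?_) (div_le_div_of_nonneg_right (hcs.trans hb) hh.le)
    simp only [Finset.mul_sum, Finset.sum_div]
    refine Finset.sum_congr rfl fun a _ => Finset.sum_congr rfl fun b _ => ?_
    have e : (Matrix.diagonal (fun a => (d a : ℂ)) * X j
        - X j * Matrix.diagonal (fun a => (d a : ℂ))) a b = ((d a - d b : ℝ) : ℂ) * X j a b := by
      rw [Matrix.sub_apply, Matrix.diagonal_mul, Matrix.mul_diagonal]
      push_cast
      ring
    rw [e, norm_mul, Complex.norm_real, Real.norm_eq_abs, ← sub_div, abs_div, abs_of_pos hh]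
    ring
  calc _ ≤ ∑ j, trNorm (X j - pinch (fun a => ⌊d a / h + θ⌋) (X j)) ^ 2 :=
        Finset.single_le_sum (f := fun j =>
          trNorm (X j - pinch (fun a => ⌊d a / h + θ⌋) (X j)) ^ 2)
          (fun _ _ => sq_nonneg _) (Finset.mem_univ j)
    _ ≤ _ := Finset.sum_le_sum fun j _ => hl j
    _ ≤ _ := hθ
    _ ≤ ∑ _j : ι, ε / h := Finset.sum_le_sum fun j _ => hr j
    _ = Fintype.card ι * ε / h := by
      rw [Finset.sum_const, Finset.card_univ, nsmul_eq_mul, mul_div_assoc]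

/-- The single-step lemma in an eigenbasis of the matrix to be discretized. -/
theorem exists_commute_diagonal {n : ℕ} {ι : Type*} [Fintype ι] (d : Fin n → ℝ)
    (hd : ∀ a, |d a| ≤ 1) (X : ι → Matrix (Fin n) (Fin n) ℂ) (hXh : ∀ j, (X j).IsHermitian)
    (hX : ∀ j, opNorm (X j) ≤ 1) {ε h : ℝ} (hh : 0 < h)
    (hc : ∀ j, trNorm (Matrix.diagonal (fun a => (d a : ℂ)) * X j
      - X j * Matrix.diagonal (fun a => (d a : ℂ))) ≤ ε) :
    ∃ (A : Matrix (Fin n) (Fin n) ℂ) (Y : ι → Matrix (Fin n) (Fin n) ℂ),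
      A.IsHermitian ∧ opNorm A ≤ 1 ∧ trNorm (Matrix.diagonal (fun a => (d a : ℂ)) - A) ≤ h ∧
      (∀ j, (Y j).IsHermitian) ∧ (∀ j, opNorm (Y j) ≤ 1) ∧
      (∀ j, trNorm (X j - Y j) ^ 2 ≤ Fintype.card ι * ε / h) ∧ (∀ j, Commute A (Y j)) ∧
      ∀ i j, Commute (X i) (Matrix.diagonal fun a => (d a : ℂ)) → Commute (X i) (X j) →
        Commute (Y i) (Y j) := by
  obtain ⟨θ, hθ⟩ := exists_trNorm_sub_pinch_sq_le d X hX hh hc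
  let z : Fin n → ℤ := fun a => ⌊d a / h + θ⌋
  -- Each eigenvalue is moved to the left end of its bin, truncated at `-1`.
  let φ : ℤ → ℝ := fun m => max (-1) (h * (m - θ))
  have hφ : ∀ a, d a - h ≤ φ (z a) ∧ φ (z a) ≤ d a := fun a => by
    have h1 := Int.floor_le (d a / h + θ)
    have h2 := Int.lt_floor_add_one (d a / h + θ)
    have e : h * (d a / h) = d a := mul_div_cancel₀ _ hh.ne'
    refine ⟨le_max_of_le_right ?_, max_le (neg_le_of_abs_le (hd a)) ?_⟩
    · have : h * (d a / h - 1) ≤ h * ((z a : ℝ) - θ) :=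
        mul_le_mul_of_nonneg_left (by simp only [z]; linarith) hh.le
      linarith
    · have : h * ((z a : ℝ) - θ) ≤ h * (d a / h) :=
        mul_le_mul_of_nonneg_left (by simp only [z]; linarith) hh.le
      linarith
  refine ⟨Matrix.diagonal fun a => (φ (z a) : ℂ), fun j => pinch z (X j), ?_, ?_, ?_,
    fun j => isHermitian_pinch z (hXh j), fun j => opNorm_pinch_le_one z (hX j), hθ,
    fun j => commute_diagonal_pinch z fun m => (φ m : ℂ), fun i j hi hij => ?_⟩
  · rw [Matrix.isHermitian_diagonal_iff]
    exact fun a => Complex.conj_ofReal _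
  · rw [opNorm_diagonal, pi_norm_le_iff_of_nonneg zero_le_one]
    intro a
    rw [Complex.norm_real, Real.norm_eq_abs, abs_le]
    exact ⟨le_max_left _ _, (hφ a).2.trans (le_of_abs_le (hd a))⟩
  · rw [Matrix.diagonal_sub]
    refine trNorm_diagonal_le hh.le fun a => ?_
    rw [← Complex.ofReal_sub, Complex.norm_real, Real.norm_eq_abs, abs_le]
    constructor <;> linarith [(hφ a).1, (hφ a).2]
  · have hz : ∀ a b, X i a b ≠ 0 → z a = z b := fun a b hab => by
      simp only [z, apply_eq_of_commute_diagonal hi hab]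
    change Commute (pinch z (X i)) (pinch z (X j))
    rw [pinch_eq_self z hz]
    exact commute_pinch z hz hij

/-- One matrix `H` of an almost commuting family of Hermitian contractions `X` can be replaced by a
nearby `A` so that, after a small change of the family, `A` commutes with all its members.
Members commuting with `H` keep their commutation relations. -/
theorem exists_commute_of_trNorm_commutator_le {n : ℕ} {ι : Type*} [Fintype ι]
    {H : Matrix (Fin n) (Fin n) ℂ} (hHh : H.IsHermitian) (hH : opNorm H ≤ 1)
    (X : ι → Matrix (Fin n) (Fin n) ℂ) (hXh : ∀ j, (X j).IsHermitian)
    (hX : ∀ j, opNorm (X j) ≤ 1) {ε h : ℝ} (hh : 0 < h)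
    (hc : ∀ j, trNorm (H * X j - X j * H) ≤ ε) :
    ∃ (A : Matrix (Fin n) (Fin n) ℂ) (Y : ι → Matrix (Fin n) (Fin n) ℂ),
      A.IsHermitian ∧ opNorm A ≤ 1 ∧ trNorm (H - A) ≤ h ∧
      (∀ j, (Y j).IsHermitian) ∧ (∀ j, opNorm (Y j) ≤ 1) ∧
      (∀ j, trNorm (X j - Y j) ^ 2 ≤ Fintype.card ι * ε / h) ∧ (∀ j, Commute A (Y j)) ∧
      ∀ i j, Commute (X i) H → Commute (X i) (X j) → Commute (Y i) (Y j) := by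
  obtain ⟨u, d, rfl⟩ : ∃ (u : unitary (Matrix (Fin n) (Fin n) ℂ)) (d : Fin n → ℝ),
      H = Unitary.conjStarAlgAut ℂ _ u (Matrix.diagonal fun a => (d a : ℂ)) :=
    ⟨hHh.eigenvectorUnitary, hHh.eigenvalues, hHh.spectral_theorem⟩
  set Φ := Unitary.conjStarAlgAut ℂ (Matrix (Fin n) (Fin n) ℂ) u
  have hΦt : ∀ B, trNorm (Φ B) = trNorm B := fun B => trNorm_conjStarAlgAut B _
  have hΦo : ∀ B, opNorm (Φ B) = opNorm B := fun B => opNorm_conjStarAlgAut B _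
  have hΦh : ∀ B, (Φ B).IsHermitian ↔ B.IsHermitian := fun B => by
    simp only [Matrix.IsHermitian, ← Matrix.star_eq_conjTranspose]
    rw [← map_star, EmbeddingLike.apply_eq_iff_eq]
  have hΦc : ∀ B C, Commute (Φ B) (Φ C) ↔ Commute B C := fun B C => by
    simp only [Commute, SemiconjBy]
    rw [← map_mul, ← map_mul, EmbeddingLike.apply_eq_iff_eq]
  obtain ⟨X, rfl⟩ : ∃ X' : ι → Matrix (Fin n) (Fin n) ℂ, X = fun j => Φ (X' j) :=
    ⟨fun j => Φ.symm (X j), by simp⟩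
  simp only [hΦh, hΦo, hΦc, ← map_mul, ← map_sub, hΦt] at hH hXh hX hc ⊢
  have hd : ∀ a, |d a| ≤ 1 := fun a => by
    rw [opNorm_diagonal, pi_norm_le_iff_of_nonneg zero_le_one] at hH
    simpa using hH a
  obtain ⟨A, Y, h1, h2, h3, h4, h5, h6, h7, h8⟩ := exists_commute_diagonal d hd X hXh hX hh hc
  refine ⟨Φ A, fun j => Φ (Y j), ?_⟩
  simp only [hΦh, hΦo, hΦc, ← map_sub, hΦt]
  exact ⟨h1, h2, h3, h4, h5, h6, h7, h8⟩

/-! ### Iteration over a family of Hermitian matrices -/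

/-- The total error after `m` discretization steps in a family of `k` Hermitian contractions whose
commutators have norm at most `ε`. Before each step the commutators are bounded by `ε` plus four
times the error so far; the bins have width the square root of that bound. -/
noncomputable def discretizationError (k : ℕ) (ε : ℝ) : ℕ → ℝ
  | 0 => 0
  | m + 1 => discretizationError k ε m + (√(ε + 4 * discretizationError k ε m)
      + √(k * √(ε + 4 * discretizationError k ε m)))

theorem discretizationError_nonneg (k : ℕ) (ε : ℝ) (m : ℕ) : 0 ≤ discretizationError k ε m := by
  induction m with
  | zero => exact le_rfl
  | succ m ih =>
    rw [discretizationError]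
    positivity

theorem tendsto_discretizationError (k m : ℕ) :
    Tendsto (fun ε => discretizationError k ε m) (𝓝 0) (𝓝 0) := by
  have h0 : discretizationError k 0 m = 0 := by
    induction m with
    | zero => rfl
    | succ m ih => simp [discretizationError, ih]
  have hcont : Continuous fun ε => discretizationError k ε m := by
    clear h0
    induction m with
    | zero => exact continuous_const
    | succ m ih =>
      simp only [discretizationError]
      fun_prop
  simpa only [h0] using hcont.tendsto 0

/-- The members of the family indexed by `S` have been discretized: they commute exactly with all
members, including those not in `S`. The latter have only been pinched. -/
theorem exists_commute_finset {n : ℕ} {ι : Type*} [Fintype ι] {ε : ℝ} (hε : 0 < ε)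
    (H : ι → Matrix (Fin n) (Fin n) ℂ) (hHh : ∀ i, (H i).IsHermitian) (hH : ∀ i, opNorm (H i) ≤ 1)
    (hc : ∀ i j, trNorm (H i * H j - H j * H i) ≤ ε) (S : Finset ι) :
    ∃ A : ι → Matrix (Fin n) (Fin n) ℂ, (∀ i, (A i).IsHermitian) ∧ (∀ i, opNorm (A i) ≤ 1) ∧
      (∀ i ∈ S, ∀ j, Commute (A i) (A j)) ∧
      ∀ j, trNorm (H j - A j) ≤ discretizationError (Fintype.card ι) ε S.card := by
  classical
  induction S using Finset.induction_on with
  | empty =>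
    refine ⟨H, hHh, hH, by simp, fun j => ?_⟩
    rw [sub_self, trNorm_zero]
    exact discretizationError_nonneg _ _ _
  | insert m S hm ih =>
    obtain ⟨X, hXh, hX, hXS, hHX⟩ := ih
    set δ := discretizationError (Fintype.card ι) ε S.card with hδ
    have hδ0 : 0 ≤ δ := discretizationError_nonneg _ _ _
    have hpos : 0 < √(ε + 4 * δ) := Real.sqrt_pos.2 (by positivity)
    obtain ⟨A, Y, hAh, hA, hXA, hYh, hY, hXY, hAY, hYY⟩ :=
      exists_commute_of_trNorm_commutator_le (hXh m) (hX m) X hXh hX hpos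
        (fun j => trNorm_commutator_le (hH m) (hH j) (hX m) (hX j) (hc m j) (hHX m) (hHX j))
    rw [Finset.card_insert_of_notMem hm, discretizationError, ← hδ]
    refine ⟨Function.update Y m A, fun i => ?_, fun i => ?_, fun i hi j => ?_, fun j => ?_⟩
    · obtain rfl | h := eq_or_ne i m
      · rwa [Function.update_self]
      · rw [Function.update_of_ne h]
        exact hYh i
    · obtain rfl | h := eq_or_ne i m
      · rwa [Function.update_self]
      · rw [Function.update_of_ne h]
        exact hY i
    · rcases eq_or_ne i m with h | h <;> rcases eq_or_ne j m with h' | h'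
      · rw [h, h']
      · rw [h, Function.update_self, Function.update_of_ne h']
        exact hAY j
      · rw [h', Function.update_self, Function.update_of_ne h]
        exact (hAY i).symm
      · rw [Function.update_of_ne h, Function.update_of_ne h']
        have hiS := (Finset.mem_insert.1 hi).resolve_left h
        exact hYY i j (hXS i hiS m) (hXS i hiS j)
    · have htri : ∀ Z, trNorm (H j - Z) ≤ δ + trNorm (X j - Z) := fun Z => by
        have := trNorm_add_le (H j - X j) (X j - Z)
        rw [sub_add_sub_cancel] at this
        linarith [hHX j]
      refine (htri _).trans ?_
      gcongr
      obtain rfl | h := eq_or_ne j m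
      · rw [Function.update_self]
        exact hXA.trans (le_add_of_nonneg_right (Real.sqrt_nonneg _))
      · rw [Function.update_of_ne h]
        refine le_add_of_nonneg_of_le hpos.le (Real.le_sqrt_of_sq_le ?_)
        have := hXY j
        rwa [mul_div_assoc, Real.div_sqrt] at this

theorem exists_commute_of_isHermitian {n : ℕ} {ι : Type*} [Fintype ι] {ε : ℝ} (hε : 0 ≤ ε)
    (H : ι → Matrix (Fin n) (Fin n) ℂ) (hHh : ∀ i, (H i).IsHermitian) (hH : ∀ i, opNorm (H i) ≤ 1)
    (hc : ∀ i j, trNorm (H i * H j - H j * H i) ≤ ε) :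
    ∃ A : ι → Matrix (Fin n) (Fin n) ℂ, (∀ i, (A i).IsHermitian) ∧ (∀ i, opNorm (A i) ≤ 1) ∧
      (∀ i j, Commute (A i) (A j)) ∧
      ∀ j, trNorm (H j - A j) ≤ discretizationError (Fintype.card ι) ε (Fintype.card ι) := by
  -- For `ε = 0` the bins would have width zero, but the matrices already commute.
  obtain rfl | hε := hε.eq_or_lt
  · refine ⟨H, hHh, hH, fun i j => sub_eq_zero.1 (eq_zero_of_trNorm_le_zero (hc i j)), fun j => ?_⟩
    rw [sub_self, trNorm_zero]
    exact discretizationError_nonneg _ _ _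
  · obtain ⟨A, h1, h2, h3, h4⟩ := exists_commute_finset hε H hHh hH hc Finset.univ
    exact ⟨A, h1, h2, fun i j => h3 i (Finset.mem_univ i) j, h4⟩

/-! ### Normal matrices -/

section Normal

variable {n : ℕ} {N M : Matrix (Fin n) (Fin n) ℂ} {ε : ℝ}

theorem trNorm_commutator_comm (A B : Matrix (Fin n) (Fin n) ℂ) :
    trNorm (A * B - B * A) = trNorm (B * A - A * B) := trNorm_sub_rev _ _

/-- With `c = c' = 1/2` or `c = -i/2 = -c'`, and likewise for `e`, this says that the real and
imaginary parts of almost commuting normal matrices almost commute. Each of the four commutators in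
the expansion has the norm of `[N, M]`. -/
theorem trNorm_commutator_add_smul_conjTranspose_le (hN : IsStarNormal N) (hM : IsStarNormal M)
    (h : trNorm (N * M - M * N) ≤ ε) {c e : ℂ} (hc : ‖c‖ = 2⁻¹) (he : ‖e‖ = 2⁻¹)
    {c' e' : ℂ} (hc' : ‖c'‖ = 2⁻¹) (he' : ‖e'‖ = 2⁻¹) :
    trNorm ((c • N + c' • star N) * (e • M + e' • star M)
      - (e • M + e' • star M) * (c • N + c' • star N)) ≤ ε := by
  have h1 : trNorm (star N * M - M * star N) ≤ ε :=
    (trNorm_commutator_conjTranspose_left hN M).trans_le h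
  have h2 : ∀ X, trNorm (X * star M - star M * X) = trNorm (X * M - M * X) := fun X => by
    rw [trNorm_commutator_comm, trNorm_commutator_comm X M]
    exact trNorm_commutator_conjTranspose_left hM X
  have hexp : (c • N + c' • star N) * (e • M + e' • star M)
      - (e • M + e' • star M) * (c • N + c' • star N) =
      (c * e) • (N * M - M * N) + (c' * e) • (star N * M - M * star N)
      + ((c * e') • (N * star M - star M * N) + (c' * e') • (star N * star M - star M * star N)) := by
    simp only [add_mul, mul_add, smul_mul_smul_comm, smul_sub, mul_comm e, mul_comm e']
    abel
  rw [hexp]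
  refine (trNorm_add_le _ _).trans ((add_le_add (trNorm_add_le _ _) (trNorm_add_le _ _)).trans ?_)
  simp only [trNorm_smul, h2, norm_mul, hc, he, hc', he']
  linarith

theorem realPart_eq_smul_add (N : Matrix (Fin n) (Fin n) ℂ) :
    (realPart N : Matrix (Fin n) (Fin n) ℂ) = (2⁻¹ : ℂ) • N + (2⁻¹ : ℂ) • star N := by
  rw [realPart_apply_coe, ← smul_add, ← Complex.coe_smul]
  simp

theorem imaginaryPart_eq_smul_add (N : Matrix (Fin n) (Fin n) ℂ) :
    (imaginaryPart N : Matrix (Fin n) (Fin n) ℂ) =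
      (-Complex.I * 2⁻¹) • N + (Complex.I * 2⁻¹) • star N := by
  rw [imaginaryPart_apply_coe, ← Complex.coe_smul]
  simp only [smul_sub, smul_smul, Complex.ofReal_inv, Complex.ofReal_ofNat, neg_mul, neg_smul]
  abel

theorem exists_commute_of_isStarNormal {ι : Type*} [Fintype ι] (hε : 0 ≤ ε)
    (N : ι → Matrix (Fin n) (Fin n) ℂ) (hNn : ∀ i, IsStarNormal (N i)) (hN : ∀ i, opNorm (N i) ≤ 1)
    (hc : ∀ i j, trNorm (N i * N j - N j * N i) ≤ ε) :
    ∃ M : ι → Matrix (Fin n) (Fin n) ℂ, (∀ i, IsStarNormal (M i)) ∧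
      (∀ i j, Commute (M i) (M j)) ∧
      ∀ j, trNorm (N j - M j) ≤ 2 * discretizationError (2 * Fintype.card ι) ε
        (2 * Fintype.card ι) := by
  let H : ι ⊕ ι → Matrix (Fin n) (Fin n) ℂ :=
    Sum.elim (fun i => (realPart (N i) : Matrix (Fin n) (Fin n) ℂ))
      (fun i => (imaginaryPart (N i) : Matrix (Fin n) (Fin n) ℂ))
  obtain ⟨A, hAh, -, hA, hHA⟩ := exists_commute_of_isHermitian hε H
    (by rintro (i | i)
        · exact (realPart (N i)).2
        · exact (imaginaryPart (N i)).2)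
    (by rintro (i | i)
        · exact (opNorm_realPart_le _).trans (hN i)
        · exact (opNorm_imaginaryPart_le _).trans (hN i))
    (by rintro (i | i) (j | j) <;>
          simp only [H, Sum.elim_inl, Sum.elim_inr, realPart_eq_smul_add, imaginaryPart_eq_smul_add]
        all_goals
          apply trNorm_commutator_add_smul_conjTranspose_le (hNn i) (hNn j) (hc i j) <;> simp)
  rw [Fintype.card_sum, ← two_mul] at hHA
  have hstar : ∀ i, star (A (Sum.inl i) + Complex.I • A (Sum.inr i)) =
      A (Sum.inl i) - Complex.I • A (Sum.inr i) := fun i => by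
    rw [star_add, star_smul, Matrix.star_eq_conjTranspose, Matrix.star_eq_conjTranspose, hAh, hAh,
      Complex.star_def, Complex.conj_I, neg_smul, sub_eq_add_neg]
  refine ⟨fun i => A (Sum.inl i) + Complex.I • A (Sum.inr i), fun i => ⟨?_⟩, fun i j => ?_,
    fun j => ?_⟩
  · rw [hstar]
    exact ((hA _ _).add_right ((hA _ _).smul_right _)).sub_left
      (((hA _ _).add_right ((hA _ _).smul_right _)).smul_left _)
  · exact ((hA _ _).add_right ((hA _ _).smul_right _)).add_left
      (((hA _ _).add_right ((hA _ _).smul_right _)).smul_left _)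
  · have e : N j - (A (Sum.inl j) + Complex.I • A (Sum.inr j)) =
        (H (Sum.inl j) - A (Sum.inl j)) + Complex.I • (H (Sum.inr j) - A (Sum.inr j)) := by
      conv_lhs => rw [← realPart_add_I_smul_imaginaryPart (N j)]
      simp only [H, Sum.elim_inl, Sum.elim_inr, smul_sub]
      abel
    rw [e]
    refine (trNorm_add_le _ _).trans ?_
    rw [trNorm_smul, Complex.norm_I, one_mul, two_mul]
    exact add_le_add (hHA _) (hHA _)

end Normal

theorem mainTheorem4 :
    (∃ δ : ℝ → ℕ → ℝ, (∀ k : ℕ, Tendsto (fun ε => δ ε k) (𝓝[>] 0) (𝓝 0)) ∧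
      ∀ (k n : ℕ) (ε : ℝ), 0 ≤ ε →
        ∀ H : Fin k → Matrix (Fin n) (Fin n) ℂ,
          (∀ i, (H i).IsHermitian) → (∀ i, opNorm (H i) ≤ 1) →
          (∀ i j, trNorm (H i * H j - H j * H i) ≤ ε) →
          ∃ A : Fin k → Matrix (Fin n) (Fin n) ℂ,
            (∀ i, (A i).IsHermitian) ∧ (∀ i, opNorm (A i) ≤ 1) ∧
            (∀ i j, A i * A j = A j * A i) ∧
            ∀ j, trNorm (H j - A j) ≤ δ ε k) ∧
    (∃ δ : ℝ → ℕ → ℝ, (∀ k : ℕ, Tendsto (fun ε => δ ε k) (𝓝[>] 0) (𝓝 0)) ∧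
      ∀ (k n : ℕ) (ε : ℝ), 0 ≤ ε →
        ∀ N : Fin k → Matrix (Fin n) (Fin n) ℂ,
          (∀ i, IsStarNormal (N i)) → (∀ i, opNorm (N i) ≤ 1) →
          (∀ i j, trNorm (N i * N j - N j * N i) ≤ ε) →
          ∃ M : Fin k → Matrix (Fin n) (Fin n) ℂ,
            (∀ i, IsStarNormal (M i)) ∧
            (∀ i j, M i * M j = M j * M i) ∧
            ∀ j, trNorm (N j - M j) ≤ δ ε k) := by
  refine ⟨⟨fun ε k => discretizationError k ε k,
    fun k => (tendsto_discretizationError k k).mono_left nhdsWithin_le_nhds,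
    fun k n ε hε H hHh hH hc => ?_⟩,
    ⟨fun ε k => 2 * discretizationError (2 * k) ε (2 * k), fun k => ?_,
    fun k n ε hε N hNn hN hc => ?_⟩⟩
  · simpa only [Fintype.card_fin] using! exists_commute_of_isHermitian hε H hHh hH hc
  · simpa using ((tendsto_discretizationError (2 * k) (2 * k)).const_mul 2).mono_left
      (nhdsWithin_le_nhds (s := Set.Ioi 0))
  · simpa only [Fintype.card_fin] using! exists_commute_of_isStarNormal hε N hNn hN hc
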